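/- All graphs are finite and simple. For a graph $G$, let $\rho(G)$ be its spectral radius, i.e. the largest eigenvalue of its adjacency matrix. A graph is $F$-free if it has no (not necessarily induced) subgraph isomorphic to $F$. Let $\mathrm{spex}(n,F)$ be the maximum of $\rho(G)$ over all $F$-free graphs $G$ of order $n$, and let $\mathrm{SPEX}(n,F)$ be the family of $F$-free graphs $G$ of order $n$ with $\rho(G)=\mathrm{spex}(n,F)$. **Theorem.** Let $F$ be a tree with bipartition classes $A$ and $B$, where $|A|\le |B|$, and suppose that $q:=|A|-1\ge 1$. Then there is an $N$ depending only on $F$ such that for every $n\ge N$, every graph in $\mathrm{SPEX}(n,F)$ contains the complete bipartite graph $K_{q,n-q}$ as a spanning subgraph. In particular, $\sqrt{q(n-q)}\le \mathrm{spex}(n,F)$ for every $n\ge N$. -/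

import Mathlib

noncomputable section

namespace SimpleGraph

open Classical in
/-- The spectral radius `ρ(G)` of a finite graph: the largest eigenvalue of its (real symmetric)
adjacency matrix. The set of eigenvalues is finite, and nonempty as soon as `G` has a vertex,
so that the supremum is a maximum (`isGreatest_rho`). -/
def rho {V : Type*} [Fintype V] (G : SimpleGraph V) : ℝ :=
  sSup {μ : ℝ | Module.End.HasEigenvalue (Matrix.toLin' (G.adjMatrix ℝ)) μ}

/-- `spex(n, F)`: the maximum spectral radius over all `F`-free graphs of order `n`.
There are finitely many such graphs, and at least one if `F` has an edge
(`isGreatest_spex`). -/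
def spex {W : Type*} (n : ℕ) (F : SimpleGraph W) : ℝ :=
  sSup {r : ℝ | ∃ G : SimpleGraph (Fin n), F.Free G ∧ G.rho = r}

/-- `SPEX(n, F)`: the family of `F`-free graphs of order `n` (on the vertex set `Fin n`) whose
spectral radius equals `spex(n, F)`. -/
def SPEX {W : Type*} (n : ℕ) (F : SimpleGraph W) : Set (SimpleGraph (Fin n)) :=
  {G | F.Free G ∧ G.rho = spex n F}

/-- `G` contains a spanning subgraph isomorphic to `K_{a,b}`. -/
def HasSpanningCompleteBipartite {V : Type*} (G : SimpleGraph V) (a b : ℕ) : Prop :=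
  ∃ H : SimpleGraph V, H ≤ G ∧ Nonempty (H ≃g completeBipartiteGraph (Fin a) (Fin b))

open Classical in
theorem isGreatest_rho {V : Type*} [Fintype V] [Nonempty V] (G : SimpleGraph V) :
    IsGreatest {μ : ℝ | Module.End.HasEigenvalue (Matrix.toLin' (G.adjMatrix ℝ)) μ} G.rho := by
  have hA : (G.adjMatrix ℝ).IsHermitian := by
    rw [Matrix.IsHermitian, Matrix.conjTranspose_eq_transpose_of_trivial]
    exact G.transpose_adjMatrix
  have hfin : {μ : ℝ | Module.End.HasEigenvalue (Matrix.toLin' (G.adjMatrix ℝ)) μ}.Finite :=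
    Module.End.finite_hasEigenvalue _
  obtain ⟨i⟩ := ‹Nonempty V›
  have hne : {μ : ℝ | Module.End.HasEigenvalue (Matrix.toLin' (G.adjMatrix ℝ)) μ}.Nonempty := by
    refine ⟨hA.eigenvalues i, ?_⟩
    have h := hA.eigenvalues_mem_spectrum_real i
    rw [← Matrix.spectrum_toLin'] at h
    exact Module.End.hasEigenvalue_iff_mem_spectrum.2 h
  exact ⟨hne.csSup_mem hfin, fun μ hμ => le_csSup hfin.bddAbove hμ⟩

theorem isGreatest_spex {W : Type*} (n : ℕ) (F : SimpleGraph W) (hF : F ≠ ⊥) :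
    IsGreatest {r : ℝ | ∃ G : SimpleGraph (Fin n), F.Free G ∧ G.rho = r} (spex n F) := by
  have hfin : {r : ℝ | ∃ G : SimpleGraph (Fin n), F.Free G ∧ G.rho = r}.Finite :=
    (Set.finite_range fun G : SimpleGraph (Fin n) => G.rho).subset
      (by rintro r ⟨G, -, rfl⟩; exact ⟨G, rfl⟩)
  have hne : {r : ℝ | ∃ G : SimpleGraph (Fin n), F.Free G ∧ G.rho = r}.Nonempty := by
    refine ⟨_, ⊥, ?_, rfl⟩
    rintro ⟨f⟩
    apply hF
    ext u v
    simpa using fun h : F.Adj u v => f.toHom.map_adj h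
  exact ⟨hne.csSup_mem hfin, fun r hr => le_csSup hfin.bddAbove hr⟩

end SimpleGraph

end

namespace SimpleGraph

open Finset
open scoped Classical

/-- Greedy embedding of a tree whose vertices have prescribed target sets. -/
theorem IsTree.exists_injective_hom {V : Type*} (G : SimpleGraph V) (k : ℕ) :
    ∀ {W : Type*} [Fintype W] (F : SimpleGraph W), F.IsTree → Fintype.card W = k + 1 →
      ∀ P : W → Finset V, (∀ w, (P w).Nonempty) →
      (∀ a b, F.Adj a b → ∀ v ∈ P a,
        #{c | ¬ Disjoint (P c) (P b)} ≤ #{u ∈ P b | G.Adj v u}) →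
      ∃ f : W → V, Function.Injective f ∧ (∀ a b, F.Adj a b → G.Adj (f a) (f b)) ∧
        ∀ w, f w ∈ P w := by
  induction k with
  | zero =>
    intro W _ F hF hk P hP _
    have hsub : Subsingleton W := Fintype.card_le_one_iff_subsingleton.1 (by omega)
    choose f hf using hP
    exact ⟨f, fun a b _ => Subsingleton.elim a b,
      fun a b h => absurd (Subsingleton.elim a b) h.ne, hf⟩
  | succ k ih =>
    intro W _ F hF hk P hP hdeg
    have hnt : Nontrivial W := Fintype.one_lt_card_iff_nontrivial.1 (by omega)
    obtain ⟨l, hl⟩ := hF.exists_vert_degree_one_of_nontrivial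
    obtain ⟨p, hp, hpu⟩ := degree_eq_one_iff_existsUnique_adj.1 hl
    have hF' : (F.induce ({l}ᶜ : Set W)).IsTree :=
      ⟨hF.1.induce_compl_singleton_of_degree_eq_one hl, hF.2.induce _⟩
    have hcard : Fintype.card ({l}ᶜ : Set W) = k + 1 := by
      rw [Fintype.card_compl_set, hk]; simp
    obtain ⟨f, hfi, hfa, hfP⟩ := ih (F.induce ({l}ᶜ : Set W)) hF' hcard (fun w => P w)
      (fun w => hP w) (by
        intro a b hab v hv
        refine le_trans ?_ (hdeg a b hab v hv)
        refine card_le_card_of_injOn Subtype.val ?_ Subtype.val_injective.injOn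
        intro c hc
        simpa using hc)
    have hpl : p ∈ ({l}ᶜ : Set W) := by simpa using hp.ne'
    have hex : ∃ u ∈ ({u ∈ P l | G.Adj (f ⟨p, hpl⟩) u} : Finset V), ∀ c, f c ≠ u := by
      by_contra! hcon
      have h1 := hdeg p l hp.symm _ (hfP ⟨p, hpl⟩)
      have h2 : ({u ∈ P l | G.Adj (f ⟨p, hpl⟩) u} : Finset V) ⊆
          (({c | ¬ Disjoint (P c) (P l)} : Finset W).erase l).image
            (fun c => if h : c ∈ ({l}ᶜ : Set W) then f ⟨c, h⟩ else f ⟨p, hpl⟩) := by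
        intro u hu
        obtain ⟨c, rfl⟩ := hcon u hu
        simp only [mem_filter] at hu
        refine mem_image.2 ⟨c.1, ?_, ?_⟩
        · simp only [mem_filter, mem_univ, true_and, mem_erase]
          exact ⟨c.2, Finset.not_disjoint_iff.2 ⟨_, hfP c, hu.1⟩⟩
        · simp
      have h3 : l ∈ ({c | ¬ Disjoint (P c) (P l)} : Finset W) := by
        simp [(hP l).ne_empty]
      have h4 := (card_le_card h2).trans card_image_le
      have h5 := card_erase_lt_of_mem h3
      omega
    obtain ⟨u, hu, hfu⟩ := hex
    simp only [mem_filter] at hu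
    refine ⟨fun w => if h : w ∈ ({l}ᶜ : Set W) then f ⟨w, h⟩ else u, ?_, ?_, ?_⟩
    · intro a b hab
      by_cases ha : a ∈ ({l}ᶜ : Set W) <;> by_cases hb : b ∈ ({l}ᶜ : Set W) <;>
        simp only [ha, hb, dite_true, dite_false] at hab
      · simpa using hfi hab
      · exact absurd hab (hfu _)
      · exact absurd hab.symm (hfu _)
      · simp only [Set.mem_compl_iff, Set.mem_singleton_iff, not_not] at ha hb
        rw [ha, hb]
    · intro a b hab
      by_cases ha : a ∈ ({l}ᶜ : Set W) <;> by_cases hb : b ∈ ({l}ᶜ : Set W) <;>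
        simp only [ha, hb, dite_true, dite_false]
      · exact hfa _ _ hab
      · simp only [Set.mem_compl_iff, Set.mem_singleton_iff, not_not] at hb
        subst hb
        obtain rfl := hpu a hab.symm
        exact hu.2
      · simp only [Set.mem_compl_iff, Set.mem_singleton_iff, not_not] at ha
        subst ha
        obtain rfl := hpu b hab
        exact hu.2.symm
      · simp only [Set.mem_compl_iff, Set.mem_singleton_iff, not_not] at ha hb
        exact absurd (ha.trans hb.symm) hab.ne
    · intro w
      by_cases hw : w ∈ ({l}ᶜ : Set W) <;> simp only [hw, dite_true, dite_false]
      · exact hfP ⟨w, hw⟩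
      · simp only [Set.mem_compl_iff, Set.mem_singleton_iff, not_not] at hw
        rw [hw]; exact hu.1

theorem IsTree.isContained_of_card_le {V W : Type*} [Fintype W] {G : SimpleGraph V}
    {F : SimpleGraph W} (hF : F.IsTree) (P : W → Finset V) (hP : ∀ w, (P w).Nonempty)
    (hdeg : ∀ a b, F.Adj a b → ∀ v ∈ P a,
      #{c | ¬ Disjoint (P c) (P b)} ≤ #{u ∈ P b | G.Adj v u}) : F.IsContained G := by
  have := hF.1.nonempty
  have hpos : 0 < Fintype.card W := Fintype.card_pos
  obtain ⟨f, hi, ha, -⟩ := IsTree.exists_injective_hom G (Fintype.card W - 1) F hF (by omega)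
    P hP hdeg
  exact ⟨⟨⟨f, fun {a b} h => ha a b h⟩, hi⟩⟩

theorem IsTree.exists_card_lt_of_free {V W : Type*} [Fintype W] {G : SimpleGraph V}
    {F : SimpleGraph W} (hF : F.IsTree) (hG : F.Free G) {S : Finset V} (hS : S.Nonempty) :
    ∃ v ∈ S, #{u ∈ S | G.Adj v u} < Fintype.card W := by
  by_contra! h
  refine hG (hF.isContained_of_card_le (fun _ => S) (fun _ => hS) fun a b _ v hv => ?_)
  exact (card_le_univ _).trans (h v hv)

theorem IsTree.isContained_of_bipartite_card_le {V W : Type*} [Fintype W] {G : SimpleGraph V}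
    {F : SimpleGraph W} (hF : F.IsTree) {A B : Finset W}
    (hAB : F.IsBipartiteWith (A : Set W) (B : Set W)) (hcover : ∀ w, w ∈ A ∨ w ∈ B)
    {L U : Finset V} (hLU : Disjoint L U) (hL : L.Nonempty) (hU : U.Nonempty)
    (hLdeg : ∀ v ∈ L, #B ≤ #{u ∈ U | G.Adj v u})
    (hUdeg : ∀ u ∈ U, #A ≤ #{v ∈ L | G.Adj u v}) : F.IsContained G := by
  have hd : ∀ w, w ∈ A → w ∉ B := fun w hA hB =>
    Set.disjoint_left.1 hAB.disjoint (mem_coe.2 hA) (mem_coe.2 hB)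
  refine hF.isContained_of_card_le (fun w => if w ∈ A then L else U) ?_ ?_
  · intro w
    split_ifs <;> assumption
  · intro a b hab v hv
    have h1 : ({c | ¬ Disjoint (if c ∈ A then L else U) (if b ∈ A then L else U)} : Finset W) ⊆
        if b ∈ A then A else B := by
      intro c hc
      simp only [mem_filter, mem_univ, true_and] at hc
      by_cases hb : b ∈ A <;> by_cases hcA : c ∈ A <;> simp only [hb, hcA, if_true, if_false] at hc ⊢
      · exact absurd hLU.symm hc
      · exact absurd hLU hc
      · exact (hcover c).resolve_left hcA
    refine (card_le_card h1).trans ?_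
    rcases hAB.mem_of_adj hab with ⟨ha, hb⟩ | ⟨ha, hb⟩
    · have hb' : b ∉ A := fun h => hd b h hb
      simp only [mem_coe] at ha
      simp only [ha, if_true] at hv
      simpa only [hb', if_false] using hLdeg v hv
    · have ha' : a ∉ A := fun h => hd a h ha
      simp only [mem_coe] at hb
      simp only [ha', if_false] at hv
      simpa only [hb, if_true] using hUdeg v hv

/-- In a graph without a copy of the tree, edges weighted by a small nonnegative function have
total weight linear in the weight of the vertices. -/
theorem IsTree.sum_adj_mul_le {V W : Type*} [Fintype W] {G : SimpleGraph V}
    {F : SimpleGraph W} (hF : F.IsTree) (hG : F.Free G) {x : V → ℝ} {m : ℝ} (S : Finset V)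
    (hx : ∀ v ∈ S, 0 ≤ x v) (hm : ∀ v ∈ S, x v ≤ m) :
    ∑ u ∈ S, ∑ v ∈ S, (if G.Adj u v then x u * x v else 0) ≤
      2 * Fintype.card W * m * ∑ v ∈ S, x v := by
  induction hn : #S generalizing S with
  | zero => simp [card_eq_zero.1 hn]
  | succ k ih =>
    obtain ⟨v, hv, hlt⟩ := hF.exists_card_lt_of_free hG (card_pos.1 (by omega : 0 < #S))
    have ih' := ih (S.erase v) (fun u hu => hx u (mem_of_mem_erase hu))
      (fun u hu => hm u (mem_of_mem_erase hu)) (by rw [card_erase_of_mem hv]; omega)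
    have hsym : ∀ u ∈ S.erase v, (if G.Adj u v then x u * x v else 0) =
        if G.Adj v u then x v * x u else 0 := fun u _ => by
      simp only [G.adj_comm u v, mul_comm (x u)]
    have hbound : ∑ u ∈ S.erase v, (if G.Adj v u then x v * x u else 0) ≤
        Fintype.card W * m * x v := by
      calc _ ≤ ∑ u ∈ S, (if G.Adj v u then x v * x u else 0) :=
            sum_le_sum_of_subset_of_nonneg (erase_subset _ _) fun u hu _ => by
              split_ifs
              · exact mul_nonneg (hx v hv) (hx u hu)
              · exact le_rfl
        _ = ∑ u ∈ S with G.Adj v u, x v * x u := (sum_filter _ _).symm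
        _ ≤ #{u ∈ S | G.Adj v u} • (x v * m) := sum_le_card_nsmul _ _ _ fun u hu =>
            mul_le_mul_of_nonneg_left (hm u (mem_filter.1 hu).1) (hx v hv)
        _ ≤ Fintype.card W * m * x v := by
            rw [nsmul_eq_mul]
            have h1 : (#{u ∈ S | G.Adj v u} : ℝ) ≤ Fintype.card W := by exact_mod_cast hlt.le
            have h2 : 0 ≤ x v * m := mul_nonneg (hx v hv) ((hx v hv).trans (hm v hv))
            nlinarith
    have e1 : ∑ u ∈ S, ∑ w ∈ S, (if G.Adj u w then x u * x w else 0) =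
        (∑ u ∈ S.erase v, ∑ w ∈ S.erase v, (if G.Adj u w then x u * x w else 0)) +
          2 * ∑ u ∈ S.erase v, (if G.Adj v u then x v * x u else 0) := by
      rw [← add_sum_erase _ _ hv, ← add_sum_erase _ _ hv]
      simp_rw [fun u => (add_sum_erase S (fun w => if G.Adj u w then x u * x w else 0) hv).symm]
      rw [sum_add_distrib, sum_congr rfl hsym]
      simp
      ring
    rw [e1, ← add_sum_erase _ _ hv]
    linarith

theorem IsTree.sum_degree_le {V W : Type*} [Fintype W] {G : SimpleGraph V}
    {F : SimpleGraph W} (hF : F.IsTree) (hG : F.Free G) (S : Finset V) :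
    ∑ u ∈ S, (#{v ∈ S | G.Adj u v} : ℝ) ≤ 2 * Fintype.card W * #S := by
  have h := hF.sum_adj_mul_le hG (x := fun _ => 1) (m := 1) S (by simp) (by simp)
  simpa using h

/-- A bipartite graph without a copy of the tree has few edges. -/
theorem IsTree.sum_card_adj_le {V W : Type*} [Fintype W] {G : SimpleGraph V}
    {F : SimpleGraph W} (hF : F.IsTree) (hG : F.Free G) {A B : Finset W}
    (hAB : F.IsBipartiteWith (A : Set W) (B : Set W)) (hcover : ∀ w, w ∈ A ∨ w ∈ B)
    {q : ℕ} (hq : #A = q + 1) (L U : Finset V) (hLU : Disjoint L U) :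
    ∑ u ∈ U, #{v ∈ L | G.Adj u v} ≤ Fintype.card W * #L + q * #U := by
  induction hn : #L + #U generalizing L U with
  | zero =>
    have : U = ∅ := card_eq_zero.1 (by omega)
    simp [this]
  | succ k ih =>
    by_cases h1 : ∃ u ∈ U, #{v ∈ L | G.Adj u v} ≤ q
    · obtain ⟨u, hu, hle⟩ := h1
      have := ih L (U.erase u) (hLU.mono_right (erase_subset _ _))
        (by have := card_erase_add_one hu; omega)
      rw [← add_sum_erase _ _ hu, ← card_erase_add_one hu]
      linarith
    by_cases h2 : ∃ v ∈ L, #{u ∈ U | G.Adj v u} < #B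
    · obtain ⟨v, hv, hlt⟩ := h2
      have := ih (L.erase v) U (hLU.mono_left (erase_subset _ _))
        (by have := card_erase_add_one hv; omega)
      have hB : #B ≤ Fintype.card W := card_le_univ _
      have e : ∑ u ∈ U, #{w ∈ L | G.Adj u w} =
          ∑ u ∈ U, #{w ∈ L.erase v | G.Adj u w} + #{u ∈ U | G.Adj v u} := by
        rw [card_filter (fun u => G.Adj v u), ← sum_add_distrib]
        refine sum_congr rfl fun u _ => ?_
        rw [card_filter, card_filter, ← add_sum_erase _ _ hv, add_comm]
        simp only [G.adj_comm]
      rw [e, ← card_erase_add_one hv]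
      linarith
    push Not at h1 h2
    rcases U.eq_empty_or_nonempty with rfl | hU
    · simp
    obtain ⟨u, hu⟩ := hU
    have hL : L.Nonempty := by
      have := h1 u hu
      obtain ⟨v, hv⟩ := card_pos.1 (by omega : 0 < #{v ∈ L | G.Adj u v})
      exact ⟨v, (mem_filter.1 hv).1⟩
    exact absurd (hF.isContained_of_bipartite_card_le hAB hcover hLU hL ⟨u, hu⟩ h2
      fun u hu => by have := h1 u hu; omega) hG

theorem IsTree.card_common_neighbors_lt {V W : Type*} [Fintype V] [Fintype W]
    {G : SimpleGraph V} {F : SimpleGraph W} (hF : F.IsTree) (hG : F.Free G) {A B : Finset W}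
    (hAB : F.IsBipartiteWith (A : Set W) (B : Set W)) (hcover : ∀ w, w ∈ A ∨ w ∈ B)
    (hA : A.Nonempty) {T : Finset V} (hT : #A ≤ #T) :
    #{u | ∀ v ∈ T, G.Adj u v} < Fintype.card W := by
  by_contra! h
  have := hF.1.nonempty
  have hpos : 0 < Fintype.card W := Fintype.card_pos
  refine hG (hF.isContained_of_bipartite_card_le hAB hcover (L := T)
    (U := ({u | ∀ v ∈ T, G.Adj u v} : Finset V)) ?_ ?_ ?_ ?_ ?_)
  · refine Finset.disjoint_left.2 fun v hv hv' => ?_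
    exact G.loopless.irrefl v ((mem_filter.1 hv').2 v hv)
  · exact card_pos.1 ((card_pos.2 hA).trans_le hT)
  · exact card_pos.1 (hpos.trans_le h)
  · intro v hv
    refine (card_le_univ B).trans (h.trans (card_le_card fun u hu => ?_))
    exact mem_filter.2 ⟨hu, ((mem_filter.1 hu).2 v hv).symm⟩
  · intro u hu
    rw [filter_true_of_mem (mem_filter.1 hu).2]
    exact hT

section Spectral

theorem isHermitian_adjMatrix_real {V : Type*} (G : SimpleGraph V) :
    (G.adjMatrix ℝ).IsHermitian := by
  rw [Matrix.IsHermitian, Matrix.conjTranspose_eq_transpose_of_trivial]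
  exact G.transpose_adjMatrix

variable {V : Type*} [Fintype V] (G : SimpleGraph V)

theorem adjMatrix_mulVec_apply_eq_sum_ite (x : V → ℝ) (u : V) :
    (G.adjMatrix ℝ).mulVec x u = ∑ v, if G.Adj u v then x v else 0 := by
  simp [Matrix.mulVec, dotProduct, adjMatrix_apply]

theorem posSemidef_rho_sub_adjMatrix [Nonempty V] :
    (algebraMap ℝ (Matrix V V ℝ) G.rho - G.adjMatrix ℝ).PosSemidef := by
  refine Matrix.posSemidef_iff_isHermitian_and_spectrum_nonneg.2 ⟨?_, ?_⟩
  · refine Matrix.IsHermitian.sub ?_ G.isHermitian_adjMatrix_real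
    rw [Matrix.IsHermitian, Matrix.conjTranspose_eq_transpose_of_trivial,
      Matrix.algebraMap_eq_diagonal, Matrix.diagonal_transpose]
  · rw [← spectrum.singleton_sub_eq]
    rintro _ ⟨r, hr, μ, hμ, rfl⟩
    obtain rfl : r = G.rho := hr
    rw [← Matrix.spectrum_toLin'] at hμ
    exact sub_nonneg.2 (G.isGreatest_rho.2 (Module.End.hasEigenvalue_iff_mem_spectrum.2 hμ))

theorem dotProduct_rho_sub_adjMatrix (x : V → ℝ) :
    star x ⬝ᵥ (algebraMap ℝ (Matrix V V ℝ) G.rho - G.adjMatrix ℝ).mulVec x =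
      G.rho * ∑ v, x v ^ 2 - ∑ u, ∑ v, if G.Adj u v then x u * x v else 0 := by
  rw [Matrix.sub_mulVec, dotProduct_sub, Algebra.algebraMap_eq_smul_one, Matrix.smul_mulVec,
    Matrix.one_mulVec]
  simp only [dotProduct, adjMatrix_mulVec_apply_eq_sum_ite, mul_sum, mul_ite, mul_zero]
  congr 1
  refine sum_congr rfl fun v _ => ?_
  simp
  ring

theorem sum_adj_mul_le_rho [Nonempty V] (x : V → ℝ) :
    ∑ u, ∑ v, (if G.Adj u v then x u * x v else 0) ≤ G.rho * ∑ v, x v ^ 2 := by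
  have h := G.posSemidef_rho_sub_adjMatrix.dotProduct_mulVec_nonneg x
  rw [dotProduct_rho_sub_adjMatrix] at h
  linarith

/-- A vector attaining the maximal Rayleigh quotient is an eigenvector. -/
theorem sum_adj_eq_rho_mul [Nonempty V] {x : V → ℝ}
    (h : G.rho * ∑ v, x v ^ 2 ≤ ∑ u, ∑ v, if G.Adj u v then x u * x v else 0) (u : V) :
    ∑ v, (if G.Adj u v then x v else 0) = G.rho * x u := by
  have h0 := (G.posSemidef_rho_sub_adjMatrix.dotProduct_mulVec_zero_iff x).1 (by
    rw [dotProduct_rho_sub_adjMatrix]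
    linarith [G.sum_adj_mul_le_rho x])
  have h1 := congrFun h0 u
  rw [Matrix.sub_mulVec, Algebra.algebraMap_eq_smul_one, Matrix.smul_mulVec, Matrix.one_mulVec,
    Pi.sub_apply, adjMatrix_mulVec_apply_eq_sum_ite] at h1
  simp only [Pi.smul_apply, smul_eq_mul, Pi.zero_apply] at h1
  linarith

theorem sum_adj_mul_eq {x : V → ℝ} {r : ℝ}
    (h : ∀ u, ∑ v, (if G.Adj u v then x v else 0) = r * x u) :
    ∑ u, ∑ v, (if G.Adj u v then x u * x v else 0) = r * ∑ v, x v ^ 2 := by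
  rw [mul_sum]
  refine sum_congr rfl fun u _ => ?_
  have : ∀ v, (if G.Adj u v then x u * x v else 0) = x u * if G.Adj u v then x v else 0 := by
    intro v; split_ifs <;> simp
  simp_rw [this]
  rw [← mul_sum, h u]
  ring

/-- The spectral radius has a nonnegative eigenvector with maximal entry one. -/
theorem exists_nonneg_eigenvector [Nonempty V] :
    ∃ x : V → ℝ, (∀ v, 0 ≤ x v) ∧ (∀ v, x v ≤ 1) ∧ (∃ z, x z = 1) ∧
      ∀ u, ∑ v, (if G.Adj u v then x v else 0) = G.rho * x u := by
  obtain ⟨y, hy⟩ := G.isGreatest_rho.1.exists_hasEigenvector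
  have hy1 : ∀ u, ∑ v, (if G.Adj u v then y v else 0) = G.rho * y u := by
    intro u
    rw [← adjMatrix_mulVec_apply_eq_sum_ite]
    have := congrFun hy.apply_eq_smul u
    simpa using this
  have hq := G.sum_adj_mul_eq hy1
  have hz : ∀ u, ∑ v, (if G.Adj u v then |y v| else 0) = G.rho * |y u| := by
    apply G.sum_adj_eq_rho_mul
    simp only [sq_abs]
    rw [← hq]
    refine sum_le_sum fun u _ => sum_le_sum fun v _ => ?_
    split_ifs
    · rw [← abs_mul]; exact le_abs_self _
    · exact le_rfl
  obtain ⟨z, -, hmax⟩ := exists_max_image univ (fun v => |y v|) univ_nonempty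
  have hpos : 0 < |y z| := by
    obtain ⟨v, hv⟩ := Function.ne_iff.1 hy.2
    exact (abs_pos.2 hv).trans_le (hmax v (mem_univ v))
  refine ⟨fun v => |y v| / |y z|, fun v => by positivity,
    fun v => (div_le_one hpos).2 (hmax v (mem_univ v)), ⟨z, div_self hpos.ne'⟩, fun u => ?_⟩
  have := congrArg (· / |y z|) (hz u)
  simp only [sum_div, ite_div, zero_div] at this
  rw [this, mul_div_assoc]

theorem le_rho_of_eigenvector [Nonempty V] {x : V → ℝ} {r : ℝ} (hx : x ≠ 0)
    (h : ∀ u, ∑ v, (if G.Adj u v then x v else 0) = r * x u) : r ≤ G.rho := by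
  have h1 := G.sum_adj_mul_le_rho x
  rw [G.sum_adj_mul_eq h] at h1
  obtain ⟨v, hv⟩ := Function.ne_iff.1 hx
  have h2 : 0 < ∑ v, x v ^ 2 :=
    sum_pos' (fun _ _ => sq_nonneg _) ⟨v, mem_univ v, by simpa using sq_pos_of_ne_zero hv⟩
  exact le_of_mul_le_mul_right h1 h2

end Spectral

section Bipartite

/-- The complete bipartite graph between a set and its complement. -/
def joinCompl {V : Type*} (T : Finset V) : SimpleGraph V where
  Adj u v := ¬ (u ∈ T ↔ v ∈ T)
  symm := ⟨fun u v h => by tauto⟩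
  loopless := ⟨fun u h => by tauto⟩

theorem nonempty_joinCompl_iso {V : Type*} [Fintype V] (T : Finset V) {a b : ℕ} (ha : #T = a)
    (hb : Fintype.card V - a = b) :
    Nonempty (joinCompl T ≃g completeBipartiteGraph (Fin a) (Fin b)) := by
  have e1 : {v // v ∈ T} ≃ Fin a := Fintype.equivFinOfCardEq (by simpa using ha)
  have e2 : {v // v ∉ T} ≃ Fin b := Fintype.equivFinOfCardEq (by
    rw [Fintype.card_subtype_compl]; simp [ha, hb])
  refine ⟨⟨(Equiv.sumCompl (· ∈ T)).symm.trans (Equiv.sumCongr e1 e2), ?_⟩⟩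
  intro u v
  by_cases hu : u ∈ T <;> by_cases hv : v ∈ T <;>
    simp [joinCompl, hu, hv, Equiv.sumCompl_symm_apply_of_pos,
      Equiv.sumCompl_symm_apply_of_neg]

theorem hasSpanningCompleteBipartite_of_adj {n q : ℕ} {G : SimpleGraph (Fin n)}
    {T : Finset (Fin n)} (hT : #T = q) (h : ∀ u ∉ T, ∀ v ∈ T, G.Adj u v) :
    G.HasSpanningCompleteBipartite q (n - q) := by
  refine ⟨joinCompl T, fun u v huv => ?_, nonempty_joinCompl_iso T hT (by simp)⟩
  have huv : ¬ (u ∈ T ↔ v ∈ T) := huv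
  by_cases hu : u ∈ T
  · exact (h v (by tauto) u hu).symm
  · exact h u hu v (by tauto)

/-- A connected bipartite graph with both classes larger than `T` is not contained in the complete
bipartite graph between `T` and its complement. -/
theorem Connected.free_joinCompl {V W : Type*} {F : SimpleGraph W}
    (hF : F.Connected) {A B : Finset W} (hAB : F.IsBipartiteWith (A : Set W) (B : Set W))
    {T : Finset V} (hA : #T < #A) (hB : #T < #B) :
    F.Free (joinCompl T) := by
  rintro ⟨f⟩
  have hd : ∀ w, w ∈ A → w ∉ B := fun w hA hB =>
    Set.disjoint_left.1 hAB.disjoint (mem_coe.2 hA) (mem_coe.2 hB)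
  have hinj : Function.Injective f := f.injective
  have hadj : ∀ a b, F.Adj a b → ¬ (f a ∈ T ↔ f b ∈ T) := fun a b h => f.toHom.map_adj h
  have key : ∀ a b, F.Reachable a b → ((f a ∈ T ↔ a ∈ A) ↔ (f b ∈ T ↔ b ∈ A)) := by
    rintro a b ⟨p⟩
    induction p with
    | nil => rfl
    | cons h p ih =>
      refine Iff.trans ?_ ih
      have h1 := hadj _ _ h
      rcases hAB.mem_of_adj h with ⟨h2, h3⟩ | ⟨h2, h3⟩
      · have := fun h => hd _ h h3
        rw [mem_coe] at h2
        tauto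
      · have := fun h => hd _ h h2
        rw [mem_coe] at h3
        tauto
  obtain ⟨r⟩ := hF.nonempty
  by_cases hr : f r ∈ T ↔ r ∈ A
  · refine absurd (card_le_card_of_injOn f (fun a ha => ?_) hinj.injOn) (not_le.2 hA)
    exact ((key r a (hF.preconnected r a)).1 hr).2 ha
  · refine absurd (card_le_card_of_injOn f (fun b hb => ?_) hinj.injOn) (not_le.2 hB)
    have h1 := mt (key r b (hF.preconnected r b)).2 hr
    have h2 : b ∉ A := fun h => hd b h hb
    rw [mem_coe]
    tauto

theorem sqrt_le_rho_joinCompl {V : Type*} [Fintype V] {T : Finset V} (hT : T.Nonempty) :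
    √((#T : ℝ) * ((Fintype.card V : ℝ) - #T)) ≤ (joinCompl T).rho := by
  obtain ⟨t, ht⟩ := hT
  have : Nonempty V := ⟨t⟩
  have hT0 : (0 : ℝ) < #T := by exact_mod_cast card_pos.2 ⟨t, ht⟩
  have hc : (#Tᶜ : ℝ) = (Fintype.card V : ℝ) - #T := by
    rw [card_compl, Nat.cast_sub (card_le_univ _)]
  rw [← hc]
  rcases Tᶜ.eq_empty_or_nonempty with h0 | ⟨s, hs⟩
  · rw [h0]
    refine (joinCompl T).le_rho_of_eigenvector (x := fun _ => 1) (Function.ne_iff.2 ⟨t, by simp⟩)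
      fun u => ?_
    have hall : ∀ v, v ∈ T := by simpa [eq_univ_iff_forall] using h0
    simp [joinCompl, hall]
  · refine (joinCompl T).le_rho_of_eigenvector
      (x := fun v => if v ∈ T then √(#Tᶜ : ℝ) else √(#T : ℝ)) (Function.ne_iff.2 ⟨s, ?_⟩) fun u => ?_
    · have := mem_compl.1 hs
      simpa [this, Real.sqrt_eq_zero'] using ne_empty_of_mem ht
    · rw [Real.sqrt_mul hT0.le]
      have h1 := Real.mul_self_sqrt hT0.le
      have h2 := Real.mul_self_sqrt (Nat.cast_nonneg (α := ℝ) #Tᶜ)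
      by_cases hu : u ∈ T
      · have : ∀ v, (if (joinCompl T).Adj u v then if v ∈ T then √(#Tᶜ : ℝ) else √(#T : ℝ) else 0)
            = if v ∈ Tᶜ then √(#T : ℝ) else 0 := by
          intro v; by_cases hv : v ∈ T <;> simp [joinCompl, hu, hv]
        simp_rw [this]
        rw [sum_ite_mem, univ_inter, sum_const, nsmul_eq_mul]
        simp only [hu, if_true]
        rw [mul_assoc, h2]; ring
      · have : ∀ v, (if (joinCompl T).Adj u v then if v ∈ T then √(#Tᶜ : ℝ) else √(#T : ℝ) else 0)
            = if v ∈ T then √(#Tᶜ : ℝ) else 0 := by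
          intro v; by_cases hv : v ∈ T <;> simp [joinCompl, hu, hv]
        simp_rw [this]
        rw [sum_ite_mem, univ_inter, sum_const, nsmul_eq_mul]
        simp only [hu, if_false]
        rw [mul_right_comm, h1]

end Bipartite

section Rewire

/-- The graph obtained by deleting all edges at `S` and joining `S` completely to `T`. -/
def rewire {V : Type*} (G : SimpleGraph V) (S T : Finset V) (hST : Disjoint S T) :
    SimpleGraph V where
  Adj u v := (u ∈ S ∧ v ∈ T) ∨ (u ∈ T ∧ v ∈ S) ∨ (u ∉ S ∧ v ∉ S ∧ G.Adj u v)
  symm := ⟨fun u v h => by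
    rcases h with h | h | h
    · exact Or.inr (Or.inl h.symm)
    · exact Or.inl h.symm
    · exact Or.inr (Or.inr ⟨h.2.1, h.1, h.2.2.symm⟩)⟩
  loopless := ⟨fun u h => by
    have this := fun (h1 : u ∈ S) (h2 : u ∈ T) => Finset.disjoint_left.1 hST h1 h2
    rcases h with h | h | h
    · exact this h.1 h.2
    · exact this h.2 h.1
    · exact G.loopless.irrefl u h.2.2⟩

theorem Free.rewire {V W : Type*} [Fintype W] {F : SimpleGraph W} {G : SimpleGraph V}
    (hG : F.Free G) {S T C : Finset V} (hST : Disjoint S T)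
    (hC : ∀ u ∈ C, ∀ v ∈ T, G.Adj u v) (hcard : 2 * Fintype.card W ≤ #C) :
    F.Free (G.rewire S T hST) := by
  rintro ⟨f⟩
  have hinj : Function.Injective f := f.injective
  have hadj : ∀ a b, F.Adj a b → (G.rewire S T hST).Adj (f a) (f b) :=
    fun a b h => f.toHom.map_adj h
  obtain ⟨D, hD, hle⟩ : ∃ D : Finset V, (∀ v ∈ D, v ∈ C ∧ ∀ w, f w ≠ v) ∧
      Fintype.card W ≤ #D := by
    refine ⟨C \ univ.image f, fun v hv => ?_, ?_⟩
    · simpa using hv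
    · have h1 := le_card_sdiff (univ.image f) C
      have h2 : #(univ.image f) ≤ Fintype.card W := card_image_le
      omega
  obtain ⟨g⟩ : Nonempty (W ↪ D) :=
    Function.Embedding.nonempty_of_card_le (by simpa using hle)
  have hgC : ∀ w, (g w : V) ∈ C := fun w => (hD _ (g w).2).1
  have hgf : ∀ w w', f w ≠ g w' := fun w w' => (hD _ (g w').2).2 w
  have hT : ∀ v, v ∈ T → v ∉ S := fun v h h' => Finset.disjoint_left.1 hST h' h
  refine hG ⟨⟨⟨fun w => if f w ∈ S then (g w : V) else f w, fun {a b} hab => ?_⟩, ?_⟩⟩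
  · rcases hadj a b hab with h | h | h
    · simpa [h.1, hT _ h.2] using hC _ (hgC a) _ h.2
    · simpa [h.2, hT _ h.1] using (hC _ (hgC b) _ h.1).symm
    · simpa [h.1, h.2.1] using h.2.2
  · intro a b hab
    change (if f a ∈ S then (g a : V) else f a) = (if f b ∈ S then (g b : V) else f b) at hab
    split_ifs at hab
    · exact g.injective (Subtype.ext hab)
    · exact absurd hab.symm (hgf _ _)
    · exact absurd hab (hgf _ _)
    · exact hinj hab

theorem sum_adj_mul_rewire {V : Type*} [Fintype V] (G : SimpleGraph V) {S T : Finset V}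
    (hST : Disjoint S T) (x : V → ℝ) :
    ∑ u, ∑ v, (if (G.rewire S T hST).Adj u v then x u * x v else 0) =
      ∑ u, ∑ v, (if G.Adj u v then x u * x v else 0) +
        2 * (∑ u ∈ S, ∑ v ∈ T, if G.Adj u v then 0 else x u * x v) -
        (∑ u ∈ S, ∑ v ∈ S, if G.Adj u v then x u * x v else 0) -
        2 * ∑ u ∈ S, ∑ v ∈ (S ∪ T)ᶜ, if G.Adj u v then x u * x v else 0 := by
  have hdis : ∀ v, v ∈ S → v ∉ T := fun v h => Finset.disjoint_left.1 hST h
  have expand : ∀ (P Q : Finset V) (f : V → V → ℝ),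
      ∑ u ∈ P, ∑ v ∈ Q, f u v = ∑ u, ∑ v, if u ∈ P ∧ v ∈ Q then f u v else 0 := by
    intro P Q f
    simp only [ite_and, sum_ite_irrel, sum_const_zero, sum_ite_mem, univ_inter]
  have double : ∀ f : V → V → ℝ, 2 * ∑ u, ∑ v, f u v = ∑ u, ∑ v, (f u v + f v u) := by
    intro f
    simp_rw [sum_add_distrib]
    rw [sum_comm (f := fun u v => f v u)]
    ring
  rw [expand S T, expand S S, expand S (S ∪ T)ᶜ, double, double]
  simp_rw [← sum_add_distrib, ← sum_sub_distrib]
  refine sum_congr rfl fun u _ => sum_congr rfl fun v _ => ?_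
  have hu := hdis u
  have hv := hdis v
  have hc := G.adj_comm u v
  by_cases h1 : u ∈ S <;> by_cases h2 : v ∈ S <;> by_cases h3 : u ∈ T <;> by_cases h4 : v ∈ T <;>
    by_cases h5 : G.Adj u v <;>
    simp_all [SimpleGraph.rewire, mul_comm]

/-- If few vertices carry large entries of the eigenvector and they have many common neighbours,
then maximality of the spectral radius forces them to be adjacent to everything else. -/
theorem IsTree.adj_of_rho_maximal {V W : Type*} [Fintype V] [Fintype W]
    {G : SimpleGraph V} {F : SimpleGraph W} (hF : F.IsTree) (hG : F.Free G) {A B : Finset W}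
    (hAB : F.IsBipartiteWith (A : Set W) (B : Set W)) (hcover : ∀ w, w ∈ A ∨ w ∈ B)
    {q : ℕ} (hqA : #A = q + 1) (hq : 1 ≤ q)
    (hmax : ∀ G' : SimpleGraph V, F.Free G' → G'.rho ≤ G.rho)
    {x : V → ℝ} (hx0 : ∀ v, 0 ≤ x v)
    (hx : ∀ u, ∑ v, (if G.Adj u v then x v else 0) = G.rho * x u)
    {T : Finset V} (hT : #T = q) (hTx : ∀ v ∈ T, 1 / 2 ≤ x v)
    (hsmall : ∀ v ∉ T, x v ≤ 1 / (8 * Fintype.card W))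
    (hC : 2 * Fintype.card W ≤ #{u | ∀ v ∈ T, G.Adj u v}) :
    ∀ u ∉ T, ∀ v ∈ T, G.Adj u v := by
  obtain ⟨z, hz⟩ : T.Nonempty := card_pos.1 (by omega)
  have : Nonempty V := ⟨z⟩
  have := hF.1.nonempty
  have hW : (0 : ℝ) < Fintype.card W := by exact_mod_cast Fintype.card_pos
  set C : Finset V := {u | ∀ v ∈ T, G.Adj u v} with hCdef
  have hCT : ∀ u ∈ C, u ∉ T := fun u hu h => G.loopless.irrefl u ((mem_filter.1 hu).2 u h)
  set S : Finset V := (T ∪ C)ᶜ with hSdef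
  have hST : Disjoint S T := Finset.disjoint_left.2 fun v hv h => by
    simp [hSdef, h] at hv
  have hSx : ∀ v ∈ S, x v ≤ 1 / (8 * Fintype.card W) := fun v hv =>
    hsmall v (Finset.disjoint_left.1 hST hv)
  have hcompl : (S ∪ T)ᶜ = C := by
    ext v
    have := hCT v
    simp only [hSdef, mem_compl, mem_union]
    tauto
  have hquad := G.sum_adj_mul_rewire hST x
  rw [hcompl] at hquad
  have hSS := hF.sum_adj_mul_le hG S (fun v _ => hx0 v) hSx
  have hSC : ∑ u ∈ S, ∑ v ∈ C, (if G.Adj u v then x u * x v else 0) ≤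
      1 / 8 * ∑ u ∈ S, x u := by
    rw [mul_sum]
    refine sum_le_sum fun u hu => ?_
    have hlt : #{v ∈ C | G.Adj u v} < Fintype.card W := by
      refine lt_of_le_of_lt (card_le_card fun v hv => ?_)
        (hF.card_common_neighbors_lt hG hAB hcover (card_pos.1 (by omega)) (T := insert u T) ?_)
      · have hv' := mem_filter.1 hv
        refine mem_filter.2 ⟨mem_univ v, fun w hw => ?_⟩
        rcases mem_insert.1 hw with rfl | hw
        · exact hv'.2.symm
        · exact (mem_filter.1 hv'.1).2 w hw
      · rw [card_insert_of_notMem (Finset.disjoint_left.1 hST hu)]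
        omega
    calc ∑ v ∈ C, (if G.Adj u v then x u * x v else 0)
        = ∑ v ∈ C with G.Adj u v, x u * x v := (sum_filter _ _).symm
      _ ≤ #{v ∈ C | G.Adj u v} • (x u * (1 / (8 * Fintype.card W))) :=
          sum_le_card_nsmul _ _ _ fun v hv =>
            mul_le_mul_of_nonneg_left (hsmall v (hCT v (mem_filter.1 hv).1)) (hx0 u)
      _ ≤ Fintype.card W * (x u * (1 / (8 * Fintype.card W))) := by
          rw [nsmul_eq_mul]
          have h1 : (#{v ∈ C | G.Adj u v} : ℝ) ≤ Fintype.card W := by exact_mod_cast hlt.le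
          exact mul_le_mul_of_nonneg_right h1 (mul_nonneg (hx0 u) (by positivity))
      _ = 1 / 8 * x u := by field_simp
  have hadd : 1 / 2 * ∑ u ∈ S, x u ≤ ∑ u ∈ S, ∑ v ∈ T, if G.Adj u v then 0 else x u * x v := by
    rw [mul_sum]
    refine sum_le_sum fun u hu => ?_
    obtain ⟨v, hv, huv⟩ : ∃ v ∈ T, ¬ G.Adj u v := by
      by_contra! h
      have : u ∈ C := mem_filter.2 ⟨mem_univ u, h⟩
      simp [hSdef, this] at hu
    refine le_trans ?_ (single_le_sum (f := fun v => if G.Adj u v then 0 else x u * x v)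
      (fun w _ => ?_) hv)
    · simp only [huv, if_false]
      nlinarith [hx0 u, hTx v hv]
    · split_ifs
      · exact le_rfl
      · exact mul_nonneg (hx0 u) (hx0 w)
  have hSS' : ∑ u ∈ S, ∑ v ∈ S, (if G.Adj u v then x u * x v else 0) ≤ 1 / 4 * ∑ v ∈ S, x v := by
    refine hSS.trans (le_of_eq ?_)
    field_simp
    ring
  have hfree : F.Free (G.rewire S T hST) :=
    hG.rewire hST (fun u hu => (mem_filter.1 hu).2) hC
  have hle := hmax _ hfree
  have hsq : 0 ≤ ∑ v, x v ^ 2 := sum_nonneg fun v _ => sq_nonneg _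
  have hsum0 : 0 ≤ ∑ v ∈ S, x v := sum_nonneg fun v _ => hx0 v
  have hGq := G.sum_adj_mul_eq hx
  have hmul := mul_le_mul_of_nonneg_right hle hsq
  have heig := (G.rewire S T hST).sum_adj_eq_rho_mul (x := x) (by linarith)
  have hSsum : ∑ v ∈ S, x v = 0 := by
    have := (G.rewire S T hST).sum_adj_mul_eq heig
    linarith
  have hSempty : S = ∅ := by
    by_contra hne
    obtain ⟨u, hu⟩ := nonempty_iff_ne_empty.2 hne
    have hxu := (sum_eq_zero_iff_of_nonneg fun v _ => hx0 v).1 hSsum u hu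
    have h1 := heig u
    rw [hxu, mul_zero] at h1
    have h2 := (sum_eq_zero_iff_of_nonneg fun v _ => by
      split_ifs
      · exact hx0 v
      · exact le_rfl).1 h1 z (mem_univ z)
    have h3 : (G.rewire S T hST).Adj u z := Or.inl ⟨hu, hz⟩
    rw [if_pos h3] at h2
    linarith [hTx z hz]
  intro u hu v hv
  have : u ∈ C := by
    by_contra h
    have : u ∈ S := by simp [hSdef, hu, h]
    simp [hSempty] at this
  exact (mem_filter.1 this).2 v hv

end Rewire

section Structure

variable {V W : Type*} [Fintype V] [Fintype W] {G : SimpleGraph V} {F : SimpleGraph W}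
  {x : V → ℝ} {r δ : ℝ}

/-- Few vertices carry an entry of at least `δ`. -/
theorem IsTree.mul_card_large_entries_le (hF : F.IsTree) (hG : F.Free G) (hr : 0 ≤ r)
    (hx1 : ∀ v, x v ≤ 1)
    (hx : ∀ u, ∑ v, (if G.Adj u v then x v else 0) = r * x u) :
    r * δ * #{v | δ ≤ x v} ≤ 2 * Fintype.card W * Fintype.card V := by
  calc r * δ * #{v | δ ≤ x v} = ∑ v with δ ≤ x v, r * δ := by
        rw [sum_const, nsmul_eq_mul, mul_comm]
    _ ≤ ∑ v with δ ≤ x v, (#{u | G.Adj v u} : ℝ) := by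
        refine sum_le_sum fun v hv => ?_
        calc r * δ ≤ r * x v := mul_le_mul_of_nonneg_left (mem_filter.1 hv).2 hr
          _ = ∑ u, (if G.Adj v u then x u else 0) := (hx v).symm
          _ ≤ ∑ u, (if G.Adj v u then 1 else 0) := sum_le_sum fun u _ => by
              split_ifs
              · exact hx1 u
              · exact le_rfl
          _ = _ := by simp
    _ ≤ ∑ v, (#{u | G.Adj v u} : ℝ) :=
        sum_le_sum_of_subset_of_nonneg (filter_subset _ _) fun _ _ _ => Nat.cast_nonneg _
    _ ≤ 2 * Fintype.card W * Fintype.card V := hF.sum_degree_le hG univ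

/-- Walks of length two from `w` are dominated by those ending in a large entry. -/
theorem IsTree.sq_mul_le_sum (hF : F.IsTree) (hG : F.Free G)
    (hx0 : ∀ v, 0 ≤ x v) (hx1 : ∀ v, x v ≤ 1) (hδ : 0 ≤ δ)
    (hx : ∀ u, ∑ v, (if G.Adj u v then x v else 0) = r * x u) {L : Finset V}
    (hL : ∀ v ∉ L, x v ≤ δ) (w : V) :
    r ^ 2 * x w ≤ ∑ u with G.Adj w u ∧ u ∉ L, ∑ v ∈ L with G.Adj u v, x v +
      2 * Fintype.card W * #L + 2 * Fintype.card W * δ * Fintype.card V := by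
  have h1 : r ^ 2 * x w = ∑ u with G.Adj w u, ∑ v, if G.Adj u v then x v else 0 := by
    simp_rw [hx]
    rw [← mul_sum, sum_filter, hx]
    ring
  have h2 : ∀ u, ∑ v, (if G.Adj u v then x v else 0) ≤
      ∑ v ∈ L with G.Adj u v, x v + δ * #{v | G.Adj u v} := by
    intro u
    have e1 : δ * (#{v | G.Adj u v} : ℝ) = ∑ v, if G.Adj u v then δ else 0 := by
      rw [← sum_filter, sum_const, nsmul_eq_mul, mul_comm]
    have e2 : ∑ v ∈ L with G.Adj u v, x v = ∑ v, if v ∈ L then if G.Adj u v then x v else 0 else 0 := by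
      rw [sum_ite_mem, univ_inter, sum_filter]
    rw [e1, e2, ← sum_add_distrib]
    refine sum_le_sum fun v _ => ?_
    by_cases hv : v ∈ L
    · simp only [hv, if_true]
      split_ifs <;> linarith
    · simp only [hv, if_false, zero_add]
      split_ifs
      · exact hL v hv
      · exact le_rfl
  have h3 : ∑ u with G.Adj w u, δ * (#{v | G.Adj u v} : ℝ) ≤
      2 * Fintype.card W * δ * Fintype.card V := by
    rw [← mul_sum]
    have := hF.sum_degree_le hG univ
    have h4 : ∑ u with G.Adj w u, (#{v | G.Adj u v} : ℝ) ≤ ∑ u, (#{v | G.Adj u v} : ℝ) :=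
      sum_le_sum_of_subset_of_nonneg (filter_subset _ _) fun _ _ _ => Nat.cast_nonneg _
    have h5 := mul_le_mul_of_nonneg_left (h4.trans this) hδ
    rw [card_univ] at h5
    linarith
  have h4 : ∑ u with G.Adj w u, ∑ v ∈ L with G.Adj u v, x v ≤
      ∑ u with G.Adj w u ∧ u ∉ L, ∑ v ∈ L with G.Adj u v, x v + 2 * Fintype.card W * #L := by
    rw [← sum_filter_add_sum_filter_not (univ.filter fun u => G.Adj w u) (fun u => u ∉ L),
      filter_filter]
    refine add_le_add le_rfl ?_
    refine le_trans ?_ (hF.sum_degree_le hG L)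
    calc _ ≤ ∑ u ∈ L, ∑ v ∈ L with G.Adj u v, x v :=
          sum_le_sum_of_subset_of_nonneg (fun u hu => by simpa using (mem_filter.1 hu).2)
            fun u _ _ => sum_nonneg fun v _ => hx0 v
      _ ≤ _ := sum_le_sum fun u _ => by
          refine (sum_le_sum fun v _ => hx1 v).trans (le_of_eq ?_)
          simp
  rw [h1]
  refine (sum_le_sum fun u _ => h2 u).trans ?_
  rw [sum_add_distrib]
  linarith

theorem card_le_card_common_add (T : Finset V) :
    Fintype.card V ≤ #{u | ∀ v ∈ T, G.Adj u v} + ∑ v ∈ T, #{u | ¬ G.Adj v u} := by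
  calc Fintype.card V = #(univ : Finset V) := card_univ.symm
    _ ≤ #(({u | ∀ v ∈ T, G.Adj u v} : Finset V) ∪ T.biUnion fun v => {u | ¬ G.Adj v u}) := by
        refine card_le_card fun u _ => ?_
        simp only [mem_union, mem_filter, mem_univ, true_and, mem_biUnion]
        by_cases h : ∀ v ∈ T, G.Adj u v
        · exact Or.inl h
        · push Not at h
          obtain ⟨v, hv, huv⟩ := h
          exact Or.inr ⟨v, hv, fun h => huv h.symm⟩
    _ ≤ _ := (card_union_le _ _).trans (Nat.add_le_add_left card_biUnion_le _)

theorem card_not_adj (v : V) : (#{u | ¬ G.Adj v u} : ℝ) = Fintype.card V - #{u | G.Adj v u} := by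
  have := card_filter_add_card_filter_not (s := (univ : Finset V)) (fun u => G.Adj v u)
  rw [card_univ] at this
  rw [← this]
  push_cast
  ring

/-- If the spectral radius is about `√(q n)`, then vertices with large entries have large degree,
and at least `q` entries are close to one. -/
theorem IsTree.degree_lower_bound_and_card_large (hF : F.IsTree) (hG : F.Free G) {A B : Finset W}
    (hAB : F.IsBipartiteWith (A : Set W) (B : Set W)) (hcover : ∀ w, w ∈ A ∨ w ∈ B)
    {q : ℕ} (hqA : #A = q + 1) (hq : 1 ≤ q)
    (hx0 : ∀ v, 0 ≤ x v) (hx1 : ∀ v, x v ≤ 1) {z : V} (hz : x z = 1)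
    (hx : ∀ u, ∑ v, (if G.Adj u v then x v else 0) = r * x u)
    {t n ε η : ℝ} (ht : t = Fintype.card W) (hn : n = Fintype.card V)
    (hε : ε = 1 / (100 * t ^ 2)) (hη : η = ε / 4) (hδ : δ = η / (3 * t))
    (hr : 6 * t ^ 2 / δ ^ 2 ≤ r) (hr2 : q * (n - q) ≤ r ^ 2)
    (hn1 : (q : ℝ) ^ 2 ≤ η * n) (hn2 : 10 * t ^ 2 ≤ n) :
    (∀ w, (x w - 2 * η) * n ≤ #{u | G.Adj w u}) ∧ q ≤ #{v | 1 - ε ≤ x v} := by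
  have hq1 : (1 : ℝ) ≤ q := by exact_mod_cast hq
  have htq : (q : ℝ) + 1 ≤ t := by
    rw [ht]
    exact_mod_cast hqA ▸ card_le_univ A
  have ht0 : 0 < t := by linarith
  have hε0 : 0 < ε := by rw [hε]; positivity
  have hη0 : 0 < η := by rw [hη]; positivity
  have hδ0 : 0 < δ := by rw [hδ]; positivity
  have hδη : 3 * t * δ = η := by rw [hδ]; field_simp
  have hεt : t * (100 * t * ε) = 1 := by rw [hε]; field_simp
  have hn0 : 0 < n := by nlinarith
  set L : Finset V := {v | δ ≤ x v} with hLdef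
  have hL : ∀ v ∉ L, x v ≤ δ := fun v hv => by
    simp only [hLdef, mem_filter, mem_univ, true_and, not_le] at hv
    exact hv.le
  have hLcard : 3 * t * #L ≤ δ * n := by
    have h1 := hF.mul_card_large_entries_le (δ := δ) hG ((by positivity : (0 : ℝ) ≤ _).trans hr)
      hx1 hx
    rw [← ht, ← hn, ← hLdef] at h1
    have h2 : 6 * t ^ 2 / δ ^ 2 * δ * #L ≤ r * δ * #L := by gcongr
    have h3 : 6 * t ^ 2 / δ ^ 2 * δ * #L = 2 * t * (3 * t * #L / δ) := by field_simp; ring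
    rw [h3] at h2
    have h4 : 3 * t * #L / δ ≤ n := by
      refine le_of_mul_le_mul_left (h2.trans h1) (by positivity)
    rw [div_le_iff₀ hδ0] at h4
    linarith
  have hr3 : (q - η) * n ≤ r ^ 2 := by nlinarith
  have hwalk : ∀ w, (q - η) * n * x w ≤
      ∑ u with G.Adj w u ∧ u ∉ L, ∑ v ∈ L with G.Adj u v, x v + 2 * t * #L + 2 * t * δ * n := by
    intro w
    have := hF.sq_mul_le_sum hG hx0 hx1 hδ0.le hx hL w
    rw [← ht, ← hn] at this
    exact (mul_le_mul_of_nonneg_right hr3 (hx0 w)).trans this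
  have hedges : ∀ w, ∑ u with G.Adj w u ∧ u ∉ L, (#{v ∈ L | G.Adj u v} : ℝ) ≤
      t * #L + q * #{u | G.Adj w u} := by
    intro w
    have h1 := hF.sum_card_adj_le hG hAB hcover hqA L ({u | G.Adj w u ∧ u ∉ L} : Finset V)
      (Finset.disjoint_right.2 fun u hu => (mem_filter.1 hu).2.2)
    have h2 : #{u | G.Adj w u ∧ u ∉ L} ≤ #{u | G.Adj w u} :=
      card_le_card fun u hu => mem_filter.2 ⟨mem_univ u, (mem_filter.1 hu).2.1⟩
    rw [ht]
    exact_mod_cast h1.trans (by gcongr)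
  have hδn : δ * n + 2 * t * δ * n ≤ η * n := by
    rw [← hδη]
    have : 0 < δ * n := mul_pos hδ0 hn0
    nlinarith
  have hdeg : ∀ w, (x w - 2 * η) * n ≤ #{u | G.Adj w u} := by
    intro w
    have h1 : ∑ u with G.Adj w u ∧ u ∉ L, ∑ v ∈ L with G.Adj u v, x v ≤
        ∑ u with G.Adj w u ∧ u ∉ L, (#{v ∈ L | G.Adj u v} : ℝ) := sum_le_sum fun u _ => by
      refine (sum_le_sum fun v _ => hx1 v).trans (le_of_eq (by simp))
    have h2 : (q - η) * n * x w ≤ q * #{u | G.Adj w u} + η * n := by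
      linarith [hwalk w, hedges w]
    have h3 : η * n * x w ≤ η * n := mul_le_of_le_one_right (by positivity) (hx1 w)
    have h4 : q * ((x w) * n) ≤ q * (#{u | G.Adj w u} : ℝ) + 2 * (η * n) := by linarith
    have h5 : 0 < η * n := by positivity
    by_contra! h6
    nlinarith
  refine ⟨hdeg, ?_⟩
  set M : Finset V := {v | 1 - ε ≤ x v} with hMdef
  by_contra! hlt
  have h1 : ∑ u with G.Adj z u ∧ u ∉ L, ∑ v ∈ L with G.Adj u v, x v ≤
      (1 - ε) * (∑ u with G.Adj z u ∧ u ∉ L, (#{v ∈ L | G.Adj u v} : ℝ)) +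
        ε * (q - 1) * n := by
    have h2 : ∀ u, ∑ v ∈ L with G.Adj u v, x v ≤
        (1 - ε) * (#{v ∈ L | G.Adj u v} : ℝ) + ε * (q - 1) := by
      intro u
      calc ∑ v ∈ L with G.Adj u v, x v
          ≤ ∑ v ∈ L with G.Adj u v, ((1 - ε) + if v ∈ M then ε else 0) :=
            sum_le_sum fun v _ => by
              by_cases hv : v ∈ M
              · simp only [hv, if_true]; linarith [hx1 v]
              · simp only [hv, if_false]
                simp only [hMdef, mem_filter, mem_univ, true_and, not_le] at hv
                linarith
        _ = (1 - ε) * (#{v ∈ L | G.Adj u v} : ℝ) +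
            #{v ∈ L.filter (fun v => G.Adj u v) | v ∈ M} * ε := by
            rw [sum_add_distrib, ← sum_filter, sum_const, sum_const, nsmul_eq_mul,
              nsmul_eq_mul, mul_comm (1 - ε)]
        _ ≤ (1 - ε) * (#{v ∈ L | G.Adj u v} : ℝ) + ε * (q - 1) := by
            have h3 : #{v ∈ L.filter (fun v => G.Adj u v) | v ∈ M} ≤ #M :=
              card_le_card fun v hv => (mem_filter.1 hv).2
            have h4 : (#{v ∈ L.filter (fun v => G.Adj u v) | v ∈ M} : ℝ) + 1 ≤ q := by
              exact_mod_cast (by omega)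
            nlinarith
    refine (sum_le_sum fun u _ => h2 u).trans ?_
    rw [sum_add_distrib, ← mul_sum, sum_const, nsmul_eq_mul]
    have h3 : (#{u | G.Adj z u ∧ u ∉ L} : ℝ) ≤ n := by
      rw [hn]; exact_mod_cast card_le_univ _
    have h4 : 0 ≤ ε * (q - 1) := mul_nonneg hε0.le (by linarith)
    have := mul_le_mul_of_nonneg_right h3 h4
    linarith
  have hdz : (#{u | G.Adj z u} : ℝ) ≤ n := by
    rw [hn]; exact_mod_cast card_le_univ _
  have hε1 : ε ≤ 1 := by nlinarith
  have h2 : (1 - ε) * (∑ u with G.Adj z u ∧ u ∉ L, (#{v ∈ L | G.Adj u v} : ℝ)) ≤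
      t * #L + (1 - ε) * (q * n) := by
    have h3 : q * (#{u | G.Adj z u} : ℝ) ≤ q * n := by gcongr
    have h4 : 0 ≤ t * #L := by positivity
    have h5 := mul_le_mul_of_nonneg_left ((hedges z).trans (add_le_add_right h3 _))
      (sub_nonneg.2 hε1)
    have h6 : 0 ≤ ε * (t * #L) := mul_nonneg hε0.le h4
    linarith
  have h3 := hwalk z
  rw [hz] at h3
  have h4 : 0 < ε * n := by positivity
  have h5 : η * n = ε * n / 4 := by rw [hη]; ring
  linarith

/-- The structure of the nonnegative eigenvector of a graph without a copy of the tree whose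
spectral radius is about `√(q n)`. -/
theorem IsTree.exists_dominating_set (hF : F.IsTree) (hG : F.Free G) {A B : Finset W}
    (hAB : F.IsBipartiteWith (A : Set W) (B : Set W)) (hcover : ∀ w, w ∈ A ∨ w ∈ B)
    {q : ℕ} (hqA : #A = q + 1) (hq : 1 ≤ q)
    (hx0 : ∀ v, 0 ≤ x v) (hx1 : ∀ v, x v ≤ 1) {z : V} (hz : x z = 1)
    (hx : ∀ u, ∑ v, (if G.Adj u v then x v else 0) = r * x u)
    {t n ε η : ℝ} (ht : t = Fintype.card W) (hn : n = Fintype.card V)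
    (hε : ε = 1 / (100 * t ^ 2)) (hη : η = ε / 4) (hδ : δ = η / (3 * t))
    (hr : 6 * t ^ 2 / δ ^ 2 ≤ r) (hr2 : q * (n - q) ≤ r ^ 2)
    (hn1 : (q : ℝ) ^ 2 ≤ η * n) (hn2 : 10 * t ^ 2 ≤ n) :
    ∃ T : Finset V, #T = q ∧ (∀ v ∈ T, 1 / 2 ≤ x v) ∧
      (∀ v ∉ T, x v ≤ 1 / (8 * Fintype.card W)) ∧
      2 * Fintype.card W ≤ #{u | ∀ v ∈ T, G.Adj u v} := by
  have hq1 : (1 : ℝ) ≤ q := by exact_mod_cast hq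
  have htq : (q : ℝ) + 1 ≤ t := by
    rw [ht]
    exact_mod_cast hqA ▸ card_le_univ A
  have ht0 : 0 < t := by linarith
  have hε0 : 0 < ε := by rw [hε]; positivity
  have hεt : t * (100 * t * ε) = 1 := by rw [hε]; field_simp
  have hn0 : 0 < n := by nlinarith
  obtain ⟨hdeg, hM⟩ := hF.degree_lower_bound_and_card_large hG hAB hcover hqA hq hx0 hx1 hz hx
    ht hn hε hη hδ hr hr2 hn1 hn2
  obtain ⟨T, hTM, hTq⟩ := exists_subset_card_eq hM
  have hTx : ∀ v ∈ T, 1 - ε ≤ x v := fun v hv => (mem_filter.1 (hTM hv)).2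
  have hmiss : ∀ v ∈ T, (#{u | ¬ G.Adj v u} : ℝ) ≤ 2 * ε * n := by
    intro v hv
    rw [card_not_adj, ← hn]
    have h1 := hdeg v
    have h2 := mul_le_mul_of_nonneg_right (hTx v hv) hn0.le
    have h3 : η * n = ε * n / 4 := by rw [hη]; ring
    have h4 : 0 < ε * n := by positivity
    linarith
  have hTsum : ∑ v ∈ T, (#{u | ¬ G.Adj v u} : ℝ) ≤ q * (2 * ε * n) := by
    have := sum_le_card_nsmul T (fun v => (#{u | ¬ G.Adj v u} : ℝ)) _ hmiss
    rwa [hTq, nsmul_eq_mul] at this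
  have htε : 100 * t * ε * n = n / t := by
    rw [eq_div_iff ht0.ne']
    calc 100 * t * ε * n * t = t * (100 * t * ε) * n := by ring
      _ = n := by rw [hεt, one_mul]
  have hqε : q * (2 * ε * n) + 2 * ε * n ≤ n / t / 50 := by
    rw [← htε]
    have : 0 < ε * n := by positivity
    nlinarith
  have hnt : 10 * t ≤ n / t := by
    rw [le_div_iff₀ ht0]; linarith
  have hnt' : 2 * (n / t) ≤ n := by
    have : n / t * t = n := div_mul_cancel₀ _ ht0.ne'
    have : 0 < n / t := by positivity
    nlinarith
  have h2ε : 0 < 2 * ε * n := by positivity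
  refine ⟨T, hTq, fun v hv => ?_, fun w hw => ?_, ?_⟩
  · have := hTx v hv
    nlinarith
  · by_contra! hwx
    have h1 := hF.card_common_neighbors_lt hG hAB hcover (card_pos.1 (by omega))
      (T := insert w T) (by rw [card_insert_of_notMem hw]; omega)
    have h2 := card_le_card_common_add (G := G) (insert w T)
    rw [sum_insert hw] at h2
    have h3 : n ≤ #{u | ∀ v ∈ insert w T, G.Adj u v} +
        (#{u | ¬ G.Adj w u} + ∑ v ∈ T, (#{u | ¬ G.Adj v u} : ℝ)) := by
      rw [hn]; exact_mod_cast h2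
    have h4 : (#{u | ∀ v ∈ insert w T, G.Adj u v} : ℝ) < t := by rw [ht]; exact_mod_cast h1
    rw [card_not_adj, ← hn] at h3
    have h5 := hdeg w
    rw [← ht] at hwx
    have h6 := mul_le_mul_of_nonneg_right hwx.le hn0.le
    have h7 : 1 / (8 * t) * n = n / t / 8 := by field_simp
    have h8 : η * n = ε * n / 4 := by rw [hη]; ring
    linarith
  · have h2 := card_le_card_common_add (G := G) T
    have h3 : n ≤ #{u | ∀ v ∈ T, G.Adj u v} + ∑ v ∈ T, (#{u | ¬ G.Adj v u} : ℝ) := by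
      rw [hn]; exact_mod_cast h2
    have h4 : 2 * t ≤ #{u | ∀ v ∈ T, G.Adj u v} := by linarith
    rw [ht] at h4
    exact_mod_cast h4

end Structure

end SimpleGraph

theorem theorem1p1 {W : Type*} [Fintype W] [DecidableEq W] (F : SimpleGraph W) (hF : F.IsTree)
    (A B : Finset W) (hAB : F.IsBipartiteWith (A : Set W) (B : Set W))
    (hcover : A ∪ B = Finset.univ) (hcard : A.card ≤ B.card)
    (q : ℕ) (hqA : A.card = q + 1) (hq : 1 ≤ q) :
    ∀ᶠ n : ℕ in Filter.atTop,
      (∀ G ∈ SimpleGraph.SPEX n F, G.HasSpanningCompleteBipartite q (n - q)) ∧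
        Real.sqrt ((q : ℝ) * ((n : ℝ) - (q : ℝ))) ≤ SimpleGraph.spex n F := by
  have hcover' : ∀ w, w ∈ A ∨ w ∈ B := fun w => by
    rw [← Finset.mem_union, hcover]; exact Finset.mem_univ w
  have hne : F ≠ ⊥ := by
    rintro rfl
    have h1 := SimpleGraph.preconnected_bot_iff_subsingleton.1 hF.1.preconnected
    have h2 := Finset.card_le_one_of_subsingleton A
    omega
  obtain ⟨t, ht⟩ : ∃ t : ℝ, t = Fintype.card W := ⟨_, rfl⟩
  have htq : (q : ℝ) + 1 ≤ t := by
    rw [ht]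
    exact_mod_cast hqA ▸ Finset.card_le_univ A
  have hq1 : (1 : ℝ) ≤ q := by exact_mod_cast hq
  have ht0 : 0 < t := by linarith
  obtain ⟨ε, hε⟩ : ∃ ε : ℝ, ε = 1 / (100 * t ^ 2) := ⟨_, rfl⟩
  obtain ⟨η, hη⟩ : ∃ η : ℝ, η = ε / 4 := ⟨_, rfl⟩
  obtain ⟨δ, hδ⟩ : ∃ δ : ℝ, δ = η / (3 * t) := ⟨_, rfl⟩
  have hη0 : 0 < η := by rw [hη, hε]; positivity
  have hcast := tendsto_natCast_atTop_atTop (R := ℝ)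
  filter_upwards [hcast.eventually_ge_atTop ((6 * t ^ 2 / δ ^ 2) ^ 2 + q),
    hcast.eventually_ge_atTop ((q : ℝ) ^ 2 / η), hcast.eventually_ge_atTop (10 * t ^ 2),
    Filter.eventually_ge_atTop (q + 1)] with n hn1 hn2 hn3 hn4
  have : Nonempty (Fin n) := ⟨⟨0, by omega⟩⟩
  have hspex := SimpleGraph.isGreatest_spex n F hne
  have hlower : √((q : ℝ) * ((n : ℝ) - (q : ℝ))) ≤ SimpleGraph.spex n F := by
    obtain ⟨T, -, hT⟩ := Finset.exists_subset_card_eq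
      (s := (Finset.univ : Finset (Fin n))) (n := q) (by simp; omega)
    have h1 := SimpleGraph.sqrt_le_rho_joinCompl (T := T) (Finset.card_pos.1 (by omega))
    rw [hT, Fintype.card_fin] at h1
    exact h1.trans (hspex.2 ⟨_, hF.1.free_joinCompl hAB (by omega) (by omega), rfl⟩)
  refine ⟨fun G hG => ?_, hlower⟩
  obtain ⟨hfree, hrho⟩ := hG
  rw [← hrho] at hlower hspex
  obtain ⟨x, hx0, hx1, ⟨z, hz⟩, hx⟩ := G.exists_nonneg_eigenvector
  have hr2 : (q : ℝ) * ((n : ℝ) - q) ≤ G.rho ^ 2 := (Real.sqrt_le_left (by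
    exact (Real.sqrt_nonneg _).trans hlower)).1 hlower
  have hr : 6 * t ^ 2 / δ ^ 2 ≤ G.rho := by
    refine (Real.le_sqrt_of_sq_le ?_).trans hlower
    nlinarith [sq_nonneg (6 * t ^ 2 / δ ^ 2)]
  obtain ⟨T, hT, hTx, hsmall, hC⟩ := hF.exists_dominating_set hfree hAB hcover' hqA hq hx0 hx1 hz
    hx ht (n := n) (by simp) hε hη hδ hr hr2 (by rwa [div_le_iff₀' hη0] at hn2) hn3
  exact SimpleGraph.hasSpanningCompleteBipartite_of_adj hT
    (hF.adj_of_rho_maximal hfree hAB hcover' hqA hq (fun G' hG' => hspex.2 ⟨G', hG', rfl⟩)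
      hx0 hx hT hTx hsmall hC)
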